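/- Let $d\ge 1$, $\sigma>0$ and $x,y\in\mathbb{R}^d$ with $x\ne y$. Put $e=(y-x)/\lVert y-x\rVert$, $m=(x+y)/2$, and for $z\in\mathbb{R}^d$ write $z_1=e^\top z\in\mathbb{R}$ and $z_{-1}=(I_d-ee^\top)z$. Let $N(\cdot\,;a,\sigma^2)$ denote the density of the normal distribution $N(a,\sigma^2)$ on $\mathbb{R}$. Draw, mutually independently, $x_1'\sim N(x_1,\sigma^2)$, $W\sim\mathrm{Unif}[0,1]$ and $\zeta\sim N(0,\sigma^2 I_d)$. If $W\,N(x_1';x_1,\sigma^2)\le N(x_1';y_1,\sigma^2)$, set $y_1'=x_1'$; otherwise set $y_1'=y_1-(x_1'-x_1)$. Output \[ x'=x_1'e+m_{-1}+\zeta_{-1},\qquad y'=y_1'e+m_{-1}+\zeta_{-1}. \] Then $(x',y')$ is distributed according to a maximal reflection coupling of $\mu=N(x,\sigma^2I_d)$ and $\nu=N(y,\sigma^2I_d)$. That is: $x'\sim\mu$ and $y'\sim\nu$; the coupling is maximal, i.e. $\mathbb{P}(x'=y')=1-\sup_A|\mu(A)-\nu(A)|$, the supremum being over Borel sets $A\subseteq\mathbb{R}^d$;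 and, almost surely, if $x'\neq y'$ then the increments $\xi=x'-x$ and $\eta=y'-y$ satisfy $\eta=(I_d-2ee^\top)\xi$. -/

import Mathlib

open MeasureTheory ProbabilityTheory
open scoped NNReal

noncomputable section

/-- Total variation distance `sup_A |μ(A) - ν(A)|` between two probability measures, the supremum
being over all measurable sets `A`. -/
def tvDistance {α : Type*} [MeasurableSpace α] (μ ν : Measure α) : ℝ :=
  ⨆ A : {A : Set α // MeasurableSet A}, |μ.real (A : Set α) - ν.real (A : Set α)|

/-- `γ` is a maximal coupling of the probability measures `μ` and `ν`: its marginals are `μ` and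
`ν`, and it attains the upper bound of the coupling inequality `γ(x' = y') ≤ 1 - ‖μ - ν‖_TV`. -/
structure IsMaximalCoupling {α : Type*} [MeasurableSpace α] (μ ν : Measure α)
    (γ : Measure (α × α)) : Prop where
  fst_eq : γ.map Prod.fst = μ
  snd_eq : γ.map Prod.snd = ν
  meet_eq : γ.real {p | p.1 = p.2} = 1 - tvDistance μ ν

/-- The normal distribution `N(x, σ² I_d)` on `ℝ^d`. -/
def isoNormal {d : ℕ} (x : EuclideanSpace ℝ (Fin d)) (σ : ℝ≥0) :
    Measure (EuclideanSpace ℝ (Fin d)) :=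
  multivariateGaussian x (((σ : ℝ) ^ 2) • (1 : Matrix (Fin d) (Fin d) ℝ))

/-- The unit vector `e = (y - x) / ‖y - x‖` (for `x ≠ y`). -/
def unitDir {d : ℕ} (x y : EuclideanSpace ℝ (Fin d)) : EuclideanSpace ℝ (Fin d) :=
  ‖y - x‖⁻¹ • (y - x)

/-- The projection `(I_d - e eᵀ) z = z - (eᵀ z) e`. -/
def orthPart {d : ℕ} (e z : EuclideanSpace ℝ (Fin d)) : EuclideanSpace ℝ (Fin d) :=
  z - inner ℝ e z • e

/-- The reflection `(I_d - 2 e eᵀ) z = z - 2 (eᵀ z) e`. -/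
def reflectAlong {d : ℕ} (e z : EuclideanSpace ℝ (Fin d)) : EuclideanSpace ℝ (Fin d) :=
  z - (2 * inner ℝ e z) • e

/-- `γ` is a maximal reflection coupling of `N(x, σ² I_d)` and `N(y, σ² I_d)`: it is a maximal
coupling and, for `γ`-almost every `p = (x', y')` with `x' ≠ y'`, the increments `ξ = x' - x` and
`η = y' - y` satisfy `η = (I_d - 2 e eᵀ) ξ`. -/
structure IsMaximalReflectionCoupling {d : ℕ} (x y : EuclideanSpace ℝ (Fin d)) (σ : ℝ≥0)
    (γ : Measure (EuclideanSpace ℝ (Fin d) × EuclideanSpace ℝ (Fin d))) : Prop where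
  maximal : IsMaximalCoupling (isoNormal x σ) (isoNormal y σ) γ
  reflection : ∀ᵐ p ∂γ, p.1 ≠ p.2 → p.2 - y = reflectAlong (unitDir x y) (p.1 - x)

/-- One run of the one-dimensional algorithm for `N(a, σ²)` and `N(b, σ²)`, as a function of the
draws `s ∼ N(a, σ²)` and `w ∼ Unif[0, 1]`. The first output is `s`. If
`w * N(s; a, σ²) ≤ N(s; b, σ²)` the second output is also `s`; otherwise it is `b + η`, where
`ξ = s - a` and `η = -ξ`. -/
def maxReflectionDraw1D (a b : ℝ) (σ : ℝ≥0) (s w : ℝ) : ℝ × ℝ :=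
  if w * gaussianPDFReal a (σ ^ 2) s ≤ gaussianPDFReal b (σ ^ 2) s then (s, s)
  else (s, b + -(s - a))

/-- One run of the `d`-dimensional algorithm for `N(x, σ² I_d)` and `N(y, σ² I_d)`, as a function
of the draws `s ∼ N(eᵀ x, σ²)` and `w ∼ Unif[0, 1]` made by the one-dimensional algorithm, and of
the draw `ζ ∼ N(0, σ² I_d)`. -/
def maxReflectionDraw {d : ℕ} (x y : EuclideanSpace ℝ (Fin d)) (σ : ℝ≥0) (s w : ℝ)
    (ζ : EuclideanSpace ℝ (Fin d)) : EuclideanSpace ℝ (Fin d) × EuclideanSpace ℝ (Fin d) :=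
  let e := unitDir x y
  let m := (1 / 2 : ℝ) • (y + x)
  let q := maxReflectionDraw1D (inner ℝ e x) (inner ℝ e y) σ s w
  (q.1 • e + orthPart e m + orthPart e ζ, q.2 • e + orthPart e m + orthPart e ζ)

end

/-! Since `y - x` is a multiple of `e`, the points `x`, `y` and `m` have the same projection
orthogonal to `e`. An isotropic normal splits into independent parts along and orthogonal to `e`
(`hasLaw_smul_add_orthPart`), so only the coordinate along `e` matters. There, let `p`, `q` be the
densities with means `a < b`. The draw `s` is kept with mass `min p q` and reflected with mass `(p -
q)⁺`. The reflection `s ↦ a + b - s` swaps `p` and `q`, so the reflected mass lands as `(q - p)⁺`,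
and `min p q + (q - p)⁺ = q` (`hasLaw_maxReflectionDraw1D_snd`). Rejection forces `q < p`, i.e. `s`
is on the side of `a`, and its mirror image on the side of `b`. Hence one half-space separates `x'`
from `y'` whenever they differ, and it attains the coupling inequality
(`IsMaximalCoupling.of_separating`). -/

section OrthPart

/-! ### Projection orthogonal to `e`. -/

variable {d : ℕ}

lemma norm_unitDir {x y : EuclideanSpace ℝ (Fin d)} (hxy : x ≠ y) : ‖unitDir x y‖ = 1 := by
  have h : ‖y - x‖ ≠ 0 := norm_ne_zero_iff.2 (sub_ne_zero.2 hxy.symm)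
  rw [unitDir, norm_smul, norm_inv, norm_norm, inv_mul_cancel₀ h]

lemma norm_smul_unitDir {x y : EuclideanSpace ℝ (Fin d)} (hxy : x ≠ y) :
    ‖y - x‖ • unitDir x y = y - x := by
  have h : ‖y - x‖ ≠ 0 := norm_ne_zero_iff.2 (sub_ne_zero.2 hxy.symm)
  rw [unitDir, smul_smul, mul_inv_cancel₀ h, one_smul]

lemma inner_unitDir_lt {x y : EuclideanSpace ℝ (Fin d)} (hxy : x ≠ y) :
    inner ℝ (unitDir x y) x < inner ℝ (unitDir x y) y := by
  have h : 0 < ‖y - x‖ := norm_pos_iff.2 (sub_ne_zero.2 hxy.symm)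
  rw [← sub_pos, ← inner_sub_right, ← norm_smul_unitDir hxy, inner_smul_right,
    real_inner_self_eq_norm_sq, norm_unitDir hxy]
  simpa using h

@[fun_prop]
lemma measurable_orthPart (e : EuclideanSpace ℝ (Fin d)) : Measurable (orthPart e) := by
  unfold orthPart
  fun_prop

lemma inner_orthPart_left (e z t : EuclideanSpace ℝ (Fin d)) :
    inner ℝ (orthPart e z) t = inner ℝ z (orthPart e t) := by
  simp only [orthPart, inner_sub_left, inner_sub_right, inner_smul_left, inner_smul_right,
    RCLike.conj_to_real]
  rw [real_inner_comm e z]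
  ring

lemma inner_self_orthPart {e : EuclideanSpace ℝ (Fin d)} (he : ‖e‖ = 1)
    (z : EuclideanSpace ℝ (Fin d)) : inner ℝ e (orthPart e z) = 0 := by
  simp [orthPart, inner_sub_right, inner_smul_right, he]

lemma norm_orthPart_sq {e : EuclideanSpace ℝ (Fin d)} (he : ‖e‖ = 1)
    (z : EuclideanSpace ℝ (Fin d)) : ‖orthPart e z‖ ^ 2 = ‖z‖ ^ 2 - inner ℝ e z ^ 2 := by
  rw [← real_inner_self_eq_norm_sq, ← real_inner_self_eq_norm_sq z]
  simp only [orthPart, inner_sub_left, inner_sub_right, inner_smul_left, inner_smul_right,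
    RCLike.conj_to_real, real_inner_self_eq_norm_sq e, he]
  rw [real_inner_comm e z]
  ring

lemma inner_smul_add_orthPart {e : EuclideanSpace ℝ (Fin d)} (he : ‖e‖ = 1) (r : ℝ)
    (u v : EuclideanSpace ℝ (Fin d)) :
    inner ℝ e (r • e + orthPart e u + orthPart e v) = r := by
  simp [inner_add_right, inner_self_orthPart he, inner_smul_right, he]

lemma orthPart_left_eq_midpoint {x y : EuclideanSpace ℝ (Fin d)} (hxy : x ≠ y) :
    orthPart (unitDir x y) ((1 / 2 : ℝ) • (y + x)) = orthPart (unitDir x y) x := by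
  have hy : y = x + ‖y - x‖ • unitDir x y := by rw [norm_smul_unitDir hxy]; abel
  have h : inner ℝ (unitDir x y) y = inner ℝ (unitDir x y) x + ‖y - x‖ := by
    have h := congrArg (inner ℝ (unitDir x y)) (norm_smul_unitDir hxy)
    rw [inner_smul_right, real_inner_self_eq_norm_sq, norm_unitDir hxy, inner_sub_right] at h
    linarith
  simp only [orthPart, inner_smul_right, inner_add_right, h]
  generalize unitDir x y = e at *
  nth_rw 1 [hy]
  module

lemma orthPart_right_eq_midpoint {x y : EuclideanSpace ℝ (Fin d)} (hxy : x ≠ y) :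
    orthPart (unitDir x y) ((1 / 2 : ℝ) • (y + x)) = orthPart (unitDir x y) y := by
  have h := orthPart_left_eq_midpoint hxy
  have hs : orthPart (unitDir x y) ((1 / 2 : ℝ) • (y + x)) =
      (1 / 2 : ℝ) • (orthPart (unitDir x y) y + orthPart (unitDir x y) x) := by
    simp only [orthPart, inner_smul_right, inner_add_right]
    module
  have : orthPart (unitDir x y) y = (2 : ℝ) • orthPart (unitDir x y) ((1 / 2 : ℝ) • (y + x)) -
      orthPart (unitDir x y) x := by
    rw [hs]; module
  rw [this, h]; module

end OrthPart

/-! ### Splitting an isotropic normal. -/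

section Gaussian

variable {d : ℕ}

lemma charFun_isoNormal (x : EuclideanSpace ℝ (Fin d)) (σ : ℝ≥0) (t : EuclideanSpace ℝ (Fin d)) :
    charFun (isoNormal x σ) t =
      Complex.exp ((inner ℝ t x : ℝ) * Complex.I - ((σ : ℝ) ^ 2 * ‖t‖ ^ 2 / 2 : ℝ)) := by
  have hS : (((σ : ℝ) ^ 2) • (1 : Matrix (Fin d) (Fin d) ℝ)).PosSemidef :=
    Matrix.PosSemidef.one.smul (sq_nonneg _)
  rw [isoNormal, charFun_multivariateGaussian hS]
  congr 2
  rw [Matrix.smul_mulVec, Matrix.one_mulVec, dotProduct_smul, EuclideanSpace.real_norm_sq_eq]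
  simp [dotProduct, pow_two]

instance isProbabilityMeasure_isoNormal (x : EuclideanSpace ℝ (Fin d)) (σ : ℝ≥0) :
    IsProbabilityMeasure (isoNormal x σ) := by
  unfold isoNormal
  infer_instance

/-- An isotropic normal vector can be sampled by drawing its component along a unit vector `e` and
its component orthogonal to `e` independently. -/
lemma hasLaw_smul_add_orthPart {Ω : Type*} [MeasurableSpace Ω] {P : Measure Ω}
    [IsProbabilityMeasure P] {e : EuclideanSpace ℝ (Fin d)} (he : ‖e‖ = 1)
    (x : EuclideanSpace ℝ (Fin d)) (σ : ℝ≥0) {T : Ω → ℝ} {ζ : Ω → EuclideanSpace ℝ (Fin d)}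
    (hT : HasLaw T (gaussianReal (inner ℝ e x) (σ ^ 2)) P) (hζ : HasLaw ζ (isoNormal 0 σ) P)
    (hTζ : IndepFun T ζ P) :
    HasLaw (fun ω => T ω • e + orthPart e x + orthPart e (ζ ω)) (isoNormal x σ) P := by
  have hTm := hT.aemeasurable
  have hζm := hζ.aemeasurable
  have hm₁ : Measurable (fun s : ℝ => s • e + orthPart e x) := by fun_prop
  have hX : AEMeasurable (fun ω => T ω • e + orthPart e x) P := by fun_prop
  have hY : AEMeasurable (fun ω => orthPart e (ζ ω)) P := by fun_prop
  refine ⟨hX.add hY, ?_⟩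
  have : IsProbabilityMeasure (P.map fun ω => T ω • e + orthPart e x + orthPart e (ζ ω)) :=
    Measure.isProbabilityMeasure_map (hX.add hY)
  refine Measure.ext_of_charFun (funext fun t => ?_)
  have hind : IndepFun (fun ω => T ω • e + orthPart e x) (fun ω => orthPart e (ζ ω)) P :=
    hTζ.comp hm₁ (measurable_orthPart e)
  rw [hind.charFun_map_fun_add_eq_mul hX hY, Pi.mul_apply]
  have h₁ : charFun (P.map fun ω => T ω • e + orthPart e x) t =
      charFun (gaussianReal (inner ℝ e x) (σ ^ 2)) (inner ℝ e t) *
        Complex.exp ((inner ℝ (orthPart e x) t : ℝ) * Complex.I) := by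
    rw [← hT.map_eq, charFun_apply, charFun_apply, integral_map hX (by fun_prop),
      integral_map hTm (by fun_prop), ← integral_mul_const]
    refine integral_congr_ae (ae_of_all _ fun ω => ?_)
    simp only [inner_add_left, inner_smul_left, RCLike.conj_to_real, RCLike.inner_apply]
    rw [← Complex.exp_add]
    congr 1
    push_cast
    ring
  have h₂ : charFun (P.map fun ω => orthPart e (ζ ω)) t =
      charFun (isoNormal 0 σ) (orthPart e t) := by
    rw [← hζ.map_eq, charFun_apply, charFun_apply, integral_map hY (by fun_prop),
      integral_map hζm (by fun_prop)]
    simp_rw [inner_orthPart_left]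
  -- The exponents agree because `‖t‖² = ⟪e, t⟫² + ‖orthPart e t‖²`.
  rw [h₁, h₂, charFun_isoNormal, charFun_isoNormal, charFun_gaussianReal, ← Complex.exp_add,
    ← Complex.exp_add, norm_orthPart_sq he, inner_orthPart_left, orthPart, inner_sub_right,
    inner_smul_right, real_inner_comm t x, real_inner_comm e x]
  congr 1
  simp
  ring

end Gaussian

/-! ### The coupling on the line. -/

section OneDimensional

lemma gaussianPDFReal_reflect (a b : ℝ) (v : ℝ≥0) (s : ℝ) :
    gaussianPDFReal a v (a + b - s) = gaussianPDFReal b v s := by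
  simp only [gaussianPDFReal]
  congr 3
  ring

/-- The comparison reduces to the sign of `(s - a)² - (s - b)² = (b - a)(2s - a - b)`. -/
lemma gaussianPDFReal_le_iff {a b : ℝ} (hab : a < b) {v : ℝ≥0} (hv : v ≠ 0) (s : ℝ) :
    gaussianPDFReal a v s ≤ gaussianPDFReal b v s ↔ (a + b) / 2 ≤ s := by
  have hv' : 0 < (v : ℝ) := by positivity
  have hc : 0 < (√(2 * Real.pi * v))⁻¹ := by positivity
  simp only [gaussianPDFReal]
  rw [mul_le_mul_iff_right₀ hc, Real.exp_le_exp, div_le_div_iff_of_pos_right (by positivity)]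
  constructor <;> intro h <;> nlinarith

@[fun_prop]
lemma measurable_maxReflectionDraw1D (a b : ℝ) (σ : ℝ≥0) :
    Measurable (fun p : ℝ × ℝ => maxReflectionDraw1D a b σ p.1 p.2) := by
  unfold maxReflectionDraw1D
  have h₁ := measurable_gaussianPDFReal a (σ ^ 2)
  have h₂ := measurable_gaussianPDFReal b (σ ^ 2)
  refine Measurable.ite (measurableSet_le ?_ ?_) ?_ ?_ <;> fun_prop

lemma maxReflectionDraw1D_fst (a b : ℝ) (σ : ℝ≥0) (s w : ℝ) :
    (maxReflectionDraw1D a b σ s w).1 = s := by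
  unfold maxReflectionDraw1D
  split_ifs <;> rfl

/-- If the two outputs differ, then they lie strictly on opposite sides of the midpoint and are
mirror images of each other. -/
lemma maxReflectionDraw1D_of_ne {a b : ℝ} (hab : a < b) {σ : ℝ≥0} (hσ : 0 < σ) {s w : ℝ}
    (hw : w ≤ 1) (h : s ≠ (maxReflectionDraw1D a b σ s w).2) :
    (maxReflectionDraw1D a b σ s w).2 = a + b - s ∧ s < (a + b) / 2 := by
  unfold maxReflectionDraw1D at h ⊢
  split_ifs at h ⊢ with hc
  · exact absurd rfl h
  · refine ⟨by simp only; ring, ?_⟩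
    by_contra! hs
    refine hc (le_trans ?_ ((gaussianPDFReal_le_iff hab (pow_pos hσ 2).ne' s).2 hs))
    exact mul_le_of_le_one_left (gaussianPDFReal_nonneg _ _ _) hw

/-- Acceptance means `w ≤ q / p`, an event of probability `min 1 (q / p)`. In the second term
`ENNReal.ofReal` truncates `p - q` to its positive part. -/
lemma lintegral_comp_maxReflectionDraw1D_unif (a b : ℝ) {σ : ℝ≥0} (hσ : 0 < σ)
    (f : ℝ → ENNReal) (s : ℝ) :
    gaussianPDF a (σ ^ 2) s *
        ∫⁻ w in Set.Icc (0 : ℝ) 1, f (maxReflectionDraw1D a b σ s w).2 =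
      ENNReal.ofReal (min (gaussianPDFReal a (σ ^ 2) s) (gaussianPDFReal b (σ ^ 2) s)) * f s +
        ENNReal.ofReal (gaussianPDFReal a (σ ^ 2) s - gaussianPDFReal b (σ ^ 2) s) *
          f (a + b - s) := by
  have hp : 0 < gaussianPDFReal a (σ ^ 2) s := gaussianPDFReal_pos _ _ _ (pow_pos hσ 2).ne'
  have hq : 0 ≤ gaussianPDFReal b (σ ^ 2) s := gaussianPDFReal_nonneg _ _ _
  unfold maxReflectionDraw1D
  rw [gaussianPDF]
  set p := gaussianPDFReal a (σ ^ 2) s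
  set q := gaussianPDFReal b (σ ^ 2) s
  have hA : MeasurableSet (Set.Iic (q / p)) := measurableSet_Iic
  have hmem : ∀ w, w * p ≤ q ↔ w ∈ Set.Iic (q / p) := fun w => (le_div_iff₀ hp).symm
  rw [← lintegral_add_compl _ hA,
    setLIntegral_congr_fun hA (g := fun _ => f s) fun w hw => by
      simp only [if_pos ((hmem w).2 hw)],
    setLIntegral_congr_fun hA.compl (g := fun _ => f (a + b - s)) fun w hw => by
      simp only [if_neg (fun h => hw ((hmem w).1 h))]
      congr 1; ring,
    setLIntegral_const, setLIntegral_const, Measure.restrict_apply hA,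
    Measure.restrict_apply hA.compl]
  have h₁ : Set.Iic (q / p) ∩ Set.Icc 0 1 = Set.Icc 0 (min 1 (q / p)) := by
    ext w; simp only [Set.mem_inter_iff, Set.mem_Iic, Set.mem_Icc, le_min_iff]; tauto
  have h₂ : (Set.Iic (q / p))ᶜ ∩ Set.Icc 0 1 = Set.Ioc (q / p) 1 := by
    ext w
    have : 0 ≤ q / p := by positivity
    simp only [Set.mem_inter_iff, Set.mem_compl_iff, Set.mem_Iic, Set.mem_Icc, Set.mem_Ioc,
      not_le]
    exact ⟨fun h => ⟨h.1, h.2.2⟩, fun h => ⟨h.1, by linarith [h.1], h.2⟩⟩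
  rw [h₁, h₂, Real.volume_Icc, Real.volume_Ioc, sub_zero, mul_add, mul_comm (f s),
    mul_comm (f (a + b - s)), ← mul_assoc, ← mul_assoc, ← ENNReal.ofReal_mul hp.le,
    ← ENNReal.ofReal_mul hp.le, mul_min_of_nonneg _ _ hp.le, mul_sub, mul_one,
    mul_div_cancel₀ _ hp.ne']

/-- The second output of the one-dimensional algorithm has law `N(b, σ²)`. -/
lemma hasLaw_maxReflectionDraw1D_snd (a b : ℝ) {σ : ℝ≥0} (hσ : 0 < σ) :
    HasLaw (fun p : ℝ × ℝ => (maxReflectionDraw1D a b σ p.1 p.2).2) (gaussianReal b (σ ^ 2))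
      ((gaussianReal a (σ ^ 2)).prod (volume.restrict (Set.Icc (0 : ℝ) 1))) := by
  have hv : σ ^ 2 ≠ 0 := (pow_pos hσ 2).ne'
  have hm : Measurable (fun p : ℝ × ℝ => (maxReflectionDraw1D a b σ p.1 p.2).2) := by fun_prop
  refine ⟨hm.aemeasurable, Measure.ext_of_lintegral _ fun f hf => ?_⟩
  have hpa := measurable_gaussianPDFReal a (σ ^ 2)
  have hpb := measurable_gaussianPDFReal b (σ ^ 2)
  have hfm : Measurable fun p : ℝ × ℝ => f (maxReflectionDraw1D a b σ p.1 p.2).2 := hf.comp hm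
  rw [lintegral_map hf hm, lintegral_prod _ hfm.aemeasurable, gaussianReal_of_var_ne_zero _ hv,
    gaussianReal_of_var_ne_zero _ hv,
    lintegral_withDensity_eq_lintegral_mul _ (measurable_gaussianPDF _ _)
      hfm.lintegral_prod_right',
    lintegral_withDensity_eq_lintegral_mul _ (measurable_gaussianPDF _ _) hf]
  simp only [Pi.mul_apply]
  simp_rw [lintegral_comp_maxReflectionDraw1D_unif a b hσ f]
  -- Only the reflected term undergoes the substitution `s ↦ a + b - s`.
  rw [lintegral_add_left (by fun_prop),
    ← lintegral_sub_left_eq_self (fun s => ENNReal.ofReal (gaussianPDFReal a (σ ^ 2) s -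
      gaussianPDFReal b (σ ^ 2) s) * f (a + b - s)) (a + b),
    ← lintegral_add_left (by fun_prop)]
  refine lintegral_congr fun s => ?_
  have hswap : gaussianPDFReal b (σ ^ 2) (a + b - s) = gaussianPDFReal a (σ ^ 2) s := by
    rw [add_comm a b, gaussianPDFReal_reflect]
  rw [gaussianPDFReal_reflect, hswap, sub_sub_cancel, ← add_mul, gaussianPDF]
  congr 1
  rcases le_total (gaussianPDFReal a (σ ^ 2) s) (gaussianPDFReal b (σ ^ 2) s) with h | h
  · rw [min_eq_left h, ← ENNReal.ofReal_add (gaussianPDFReal_nonneg _ _ _) (sub_nonneg.2 h),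
      add_sub_cancel]
  · rw [min_eq_right h, ENNReal.ofReal_of_nonpos (sub_nonpos.2 h), add_zero]

end OneDimensional

/-! ### Coupling inequality and its equality case. -/

section Coupling

variable {α : Type*} [MeasurableSpace α]

/-- The mass of pairs with both coordinates in `A` cancels. -/
lemma real_map_fst_sub_real_map_snd (γ : Measure (α × α)) [IsProbabilityMeasure γ]
    {A : Set α} (hA : MeasurableSet A) :
    (γ.map Prod.fst).real A - (γ.map Prod.snd).real A =
      γ.real {p | p.1 ∈ A ∧ p.2 ∉ A} - γ.real {p | p.2 ∈ A ∧ p.1 ∉ A} := by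
  have h₁ : MeasurableSet (Prod.fst ⁻¹' A : Set (α × α)) := measurable_fst hA
  have h₂ : MeasurableSet (Prod.snd ⁻¹' A : Set (α × α)) := measurable_snd hA
  rw [map_measureReal_apply measurable_fst hA, map_measureReal_apply measurable_snd hA,
    ← measureReal_inter_add_sdiff (s := Prod.fst ⁻¹' A) h₂,
    ← measureReal_inter_add_sdiff (s := Prod.snd ⁻¹' A) h₁, Set.inter_comm]
  simp only [Set.sdiff_eq, Set.preimage, Set.compl_def, Set.inter_def, Set.mem_ofPred_eq]
  ring

/-- The coupling inequality. -/
lemma abs_real_map_fst_sub_real_map_snd_le (γ : Measure (α × α)) [IsProbabilityMeasure γ] :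
    ∀ A : {A : Set α // MeasurableSet A},
      |(γ.map Prod.fst).real (A : Set α) - (γ.map Prod.snd).real (A : Set α)| ≤
        γ.real {p | p.1 ≠ p.2} := by
  rintro ⟨A, hA⟩
  rw [real_map_fst_sub_real_map_snd γ hA]
  refine abs_sub_le_of_nonneg_of_le measureReal_nonneg (measureReal_mono ?_) measureReal_nonneg
    (measureReal_mono ?_)
  · rintro p ⟨h₁, h₂⟩ h
    exact h₂ (h ▸ h₁)
  · rintro p ⟨h₁, h₂⟩ h
    exact h₂ (h ▸ h₁)

/-- A coupling is maximal as soon as some measurable set separates the two coordinates whenever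
they differ. -/
lemma IsMaximalCoupling.of_separating [MeasurableEq α] {μ ν : Measure α} {γ : Measure (α × α)}
    [IsProbabilityMeasure γ] (hμ : γ.map Prod.fst = μ) (hν : γ.map Prod.snd = ν) {A : Set α}
    (hA : MeasurableSet A) (h : ∀ᵐ p ∂γ, p.1 ≠ p.2 → p.1 ∈ A ∧ p.2 ∉ A) :
    IsMaximalCoupling μ ν γ := by
  refine ⟨hμ, hν, ?_⟩
  have hD : MeasurableSet {p : α × α | p.1 = p.2} :=
    measurableSet_eq_fun measurable_fst measurable_snd
  have hne : {p : α × α | p.1 ≠ p.2} = {p : α × α | p.1 = p.2}ᶜ := rfl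
  have hsep : |μ.real A - ν.real A| = γ.real {p | p.1 ≠ p.2} := by
    rw [← hμ, ← hν, real_map_fst_sub_real_map_snd γ hA]
    have h₁ : γ.real {p | p.1 ∈ A ∧ p.2 ∉ A} = γ.real {p | p.1 ≠ p.2} := by
      refine measureReal_congr ?_
      filter_upwards [h] with p hp
      refine propext ⟨fun hp' heq => ?_, hp⟩
      exact hp'.2 (heq ▸ hp'.1)
    have h₂ : γ.real {p | p.2 ∈ A ∧ p.1 ∉ A} = 0 := by
      rw [measureReal_eq_zero_iff]
      refine measure_eq_zero_iff_ae_notMem.2 ?_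
      filter_upwards [h] with p hp hp'
      exact hp'.2 (hp fun heq => hp'.2 (heq ▸ hp'.1)).1
    rw [h₁, h₂, sub_zero, abs_of_nonneg measureReal_nonneg]
  have htv : tvDistance μ ν = γ.real {p | p.1 ≠ p.2} := by
    have hle := abs_real_map_fst_sub_real_map_snd_le γ
    rw [hμ, hν] at hle
    have : Nonempty {A : Set α // MeasurableSet A} := ⟨⟨A, hA⟩⟩
    refine le_antisymm (ciSup_le hle) ?_
    rw [← hsep]
    -- A real supremum needs a bounded range; `hle` bounds it.
    exact le_ciSup (f := fun A : {A : Set α // MeasurableSet A} =>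
      |μ.real (A : Set α) - ν.real (A : Set α)|) ⟨_, Set.forall_mem_range.2 hle⟩ ⟨A, hA⟩
  rw [htv, hne, probReal_compl_eq_one_sub hD]
  ring

end Coupling

/-! ### The coupling in `ℝ^d`. -/

lemma measurable_maxReflectionDraw {d : ℕ} (x y : EuclideanSpace ℝ (Fin d)) (σ : ℝ≥0) :
    Measurable (fun p : (ℝ × ℝ) × EuclideanSpace ℝ (Fin d) =>
      maxReflectionDraw x y σ p.1.1 p.1.2 p.2) := by
  have h : Measurable (fun p : (ℝ × ℝ) × EuclideanSpace ℝ (Fin d) => maxReflectionDraw1D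
      (inner ℝ (unitDir x y) x) (inner ℝ (unitDir x y) y) σ p.1.1 p.1.2) :=
    (measurable_maxReflectionDraw1D _ _ σ).comp measurable_fst
  unfold maxReflectionDraw
  fun_prop

/-- Where the two outputs differ, they come from one-dimensional draws on opposite sides of the
midpoint that are mirror images of each other. -/
lemma maxReflectionDraw_of_ne {d : ℕ} {x y : EuclideanSpace ℝ (Fin d)} (hxy : x ≠ y) {σ : ℝ≥0}
    (hσ : 0 < σ) {s w : ℝ} {ζ : EuclideanSpace ℝ (Fin d)} (hw : w ≤ 1)
    (h : (maxReflectionDraw x y σ s w ζ).1 ≠ (maxReflectionDraw x y σ s w ζ).2) :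
    (maxReflectionDraw1D (inner ℝ (unitDir x y) x) (inner ℝ (unitDir x y) y) σ s w).2 =
        inner ℝ (unitDir x y) x + inner ℝ (unitDir x y) y - s ∧
      s < (inner ℝ (unitDir x y) x + inner ℝ (unitDir x y) y) / 2 := by
  have h' : s ≠
      (maxReflectionDraw1D (inner ℝ (unitDir x y) x) (inner ℝ (unitDir x y) y) σ s w).2 := by
    intro heq
    apply h
    simp only [maxReflectionDraw, maxReflectionDraw1D_fst]
    rw [← heq]
  exact maxReflectionDraw1D_of_ne (inner_unitDir_lt hxy) hσ hw h'

theorem lemma9 {d : ℕ} (x y : EuclideanSpace ℝ (Fin d)) (hxy : x ≠ y) (σ : ℝ≥0) (hσ : 0 < σ)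
    {Ω : Type*} [MeasurableSpace Ω] (P : Measure Ω) [IsProbabilityMeasure P]
    (S W : Ω → ℝ) (ζ : Ω → EuclideanSpace ℝ (Fin d))
    (hS : HasLaw S (gaussianReal (inner ℝ (unitDir x y) x) (σ ^ 2)) P)
    (hW : HasLaw W (volume.restrict (Set.Icc (0 : ℝ) 1)) P)
    (hζ : HasLaw ζ (isoNormal 0 σ) P)
    (hSW : IndepFun S W P)
    (hSWζ : IndepFun (fun ω => (S ω, W ω)) ζ P) :
    IsMaximalReflectionCoupling x y σ
      (P.map (fun ω => maxReflectionDraw x y σ (S ω) (W ω) (ζ ω))) := by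
  have he := norm_unitDir hxy
  have hF : AEMeasurable (fun ω => maxReflectionDraw x y σ (S ω) (W ω) (ζ ω)) P :=
    (measurable_maxReflectionDraw x y σ).comp_aemeasurable (f := fun ω => ((S ω, W ω), ζ ω))
      ((hS.aemeasurable.prodMk hW.aemeasurable).prodMk hζ.aemeasurable)
  have := Measure.isProbabilityMeasure_map hF
  have hw : ∀ᵐ ω ∂P, W ω ≤ 1 :=
    (hW.ae_iff (p := fun w => w ≤ 1) (measurableSet_setOfPred.1 measurableSet_Iic)).2
      ((ae_restrict_mem measurableSet_Icc).mono fun w hw => hw.2)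
  have hne : ∀ᵐ ω ∂P, (maxReflectionDraw x y σ (S ω) (W ω) (ζ ω)).1 ≠
      (maxReflectionDraw x y σ (S ω) (W ω) (ζ ω)).2 →
      (maxReflectionDraw1D (inner ℝ (unitDir x y) x) (inner ℝ (unitDir x y) y) σ (S ω) (W ω)).2 =
          inner ℝ (unitDir x y) x + inner ℝ (unitDir x y) y - S ω ∧
        S ω < (inner ℝ (unitDir x y) x + inner ℝ (unitDir x y) y) / 2 := by
    filter_upwards [hw] with ω hω h
    exact maxReflectionDraw_of_ne hxy hσ hω h
  have hmeasNe : MeasurableSet {p : EuclideanSpace ℝ (Fin d) × EuclideanSpace ℝ (Fin d) |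
      p.1 ≠ p.2} := (measurableSet_eq_fun measurable_fst measurable_snd).compl
  have hm₁ : Measurable (fun p : EuclideanSpace ℝ (Fin d) × EuclideanSpace ℝ (Fin d) =>
      reflectAlong (unitDir x y) (p.1 - x)) := by
    unfold reflectAlong
    fun_prop
  -- The separating set: the open half-space on the side of `x` of the perpendicular bisector.
  have hA : MeasurableSet {z : EuclideanSpace ℝ (Fin d) | inner ℝ (unitDir x y) z <
      (inner ℝ (unitDir x y) x + inner ℝ (unitDir x y) y) / 2} :=
    measurableSet_lt (by fun_prop) measurable_const
  refine ⟨IsMaximalCoupling.of_separating ?_ ?_ hA ?_, ?_⟩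
  · rw [AEMeasurable.map_map_of_aemeasurable measurable_fst.aemeasurable hF]
    have hSζ : IndepFun S ζ P := hSWζ.comp measurable_fst measurable_id
    simpa only [Function.comp_def, maxReflectionDraw, maxReflectionDraw1D_fst,
      orthPart_left_eq_midpoint hxy] using (hasLaw_smul_add_orthPart he x σ hS hζ hSζ).map_eq
  · rw [AEMeasurable.map_map_of_aemeasurable measurable_snd.aemeasurable hF]
    have hT := (hasLaw_maxReflectionDraw1D_snd (inner ℝ (unitDir x y) x)
      (inner ℝ (unitDir x y) y) hσ).fun_comp (hSW.hasLaw_prod hS hW)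
    -- The second coordinate depends on `(S, W)` jointly, so joint independence from `ζ` is needed.
    have hTζ := hSWζ.comp (measurable_maxReflectionDraw1D (inner ℝ (unitDir x y) x)
      (inner ℝ (unitDir x y) y) σ).snd measurable_id
    simpa only [Function.comp_def, maxReflectionDraw, orthPart_right_eq_midpoint hxy]
      using (hasLaw_smul_add_orthPart he y σ hT hζ hTζ).map_eq
  · rw [ae_map_iff hF]
    · filter_upwards [hne] with ω h hω
      obtain ⟨h₁, h₂⟩ := h hω
      simp only [maxReflectionDraw, inner_smul_add_orthPart he, h₁,
        maxReflectionDraw1D_fst]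
      exact ⟨h₂, by linarith⟩
    · exact hmeasNe.imp ((measurable_fst hA).inter (measurable_snd hA.compl))
  · rw [ae_map_iff hF]
    · filter_upwards [hne] with ω h hω
      obtain ⟨h₁, -⟩ := h hω
      have hx := orthPart_left_eq_midpoint hxy
      have hy := orthPart_right_eq_midpoint hxy
      have hx' : inner ℝ (unitDir x y)
          ((maxReflectionDraw x y σ (S ω) (W ω) (ζ ω)).1 - x) =
          S ω - inner ℝ (unitDir x y) x := by
        rw [inner_sub_right, maxReflectionDraw]
        simp only [inner_smul_add_orthPart he, maxReflectionDraw1D_fst]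
      rw [reflectAlong, hx']
      simp only [maxReflectionDraw, h₁, maxReflectionDraw1D_fst]
      -- The projection of `m` is read as that of `y` in `y'` and of `x` in `x'`, so that it cancels
      -- against the subtracted point up to a multiple of `e`.
      nth_rw 1 [hy]
      rw [hx]
      simp only [orthPart]
      module
    · exact hmeasNe.imp (measurableSet_eq_fun (by fun_prop) hm₁)
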